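/- **Corollary 3.9.** For an infinite cardinal $\kappa$ and a set $X$, let $S_\kappa(X)$ be the group of permutations $g$ of $X$ whose support $\{x : g(x)\neq x\}$ has cardinality $<\kappa$, and let $\mathcal P_\kappa(X)$ be the ring of subsets of $X$ of cardinality $<\kappa$, with symmetric difference as addition and intersection as multiplication. For $\aleph_0\le\kappa<\lambda\le\mu^+$ and a set $X$ of cardinality $\mu$, the group $G=S_\lambda(X)/S_\kappa(X)$ acts on the quotient ring $R=\mathcal P_\lambda(X)/\mathcal P_\kappa(X)$ by ring automorphisms: the class of $g$ sends the class of $A$ to the class of $g(A)=\{g(a):a\in A\}$. (Products of permutations are taken so that this is a left action.) The ring $R$ and this action of $G$ are interpretable, without parameters, inside the group $G$, uniformly in $\kappa,\lambda,\mu$. That is, there are a natural number $n$ and first-order formulas (without parameters) of the language of groups $$\mathrm{dom}(\bar x),\quad \mathrm{eq}(\bar x,\bar y),\quad \mathrm{zero}(\bar x),\quad \mathrm{neg}(\bar x,\bar y),\quad \mathrm{add}(\bar x,\bar y,\bar z),\quad \mathrm{mul}(\bar x,\bar y,\bar z),\quad \mathrm{act}(w,\bar x,\bar y),$$ in which $\bar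 x,\bar y,\bar z$ are $n$-tuples of variables and $w$ is a single variable, such that for all $\kappa,\lambda,\mu$ with $\aleph_0\le\kappa<\lambda\le\mu^+$ and every set $X$ of cardinality $\mu$, with $G$ and $R$ as above and $D=\{\bar a\in G^n : G\models\mathrm{dom}(\bar a)\}$, there is a surjection $f:D\to R$ such that for all $\bar a,\bar b,\bar c\in D$ and $g\in G$: - $G\models\mathrm{eq}(\bar a,\bar b)$ if and only if $f(\bar a)=f(\bar b)$; - $G\models\mathrm{zero}(\bar a)$ if and only if $f(\bar a)=0$; - $G\models\mathrm{neg}(\bar a,\bar b)$ if and only if $-f(\bar a)=f(\bar b)$; - $G\models\mathrm{add}(\bar a,\bar b,\bar c)$ if and only if $f(\bar a)+f(\bar b)=f(\bar c)$; - $G\models\mathrm{mul}(\bar a,\bar b,\bar c)$ if and only if $f(\bar a)\cdot f(\bar b)=f(\bar c)$; - $G\models\mathrm{act}(g,\bar a,\bar b)$ if and only if $g\cdot f(\bar a)=f(\bar b)$. -/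

import Mathlib

open Cardinal

universe u v w

namespace QuotSym

/-! ### First-order languages of groups and of (not necessarily unital) rings -/

/-- Function symbols `1`, `⁻¹`, `*` of the language of groups. -/
inductive GroupFunc : ℕ → Type
  | one : GroupFunc 0
  | inv : GroupFunc 1
  | mul : GroupFunc 2

/-- The first-order language of groups. -/
def groupLang : FirstOrder.Language.{0, 0} where
  Functions := GroupFunc
  Relations := fun _ => Empty

/-- Every group is a structure for the language of groups in the standard way. -/
instance groupStructure (G : Type v) [Group G] : groupLang.Structure G where
  funMap := fun {_} f => match f with
    | GroupFunc.one => fun _ => 1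
    | GroupFunc.inv => fun x => (x 0)⁻¹
    | GroupFunc.mul => fun x => x 0 * x 1
  RelMap := fun r => Empty.elim r

/-- Function symbols `0`, `-`, `+`, `*` of the language of not necessarily unital rings. -/
inductive RngFunc : ℕ → Type
  | zero : RngFunc 0
  | neg : RngFunc 1
  | add : RngFunc 2
  | mul : RngFunc 2

/-- The first-order language of not necessarily unital rings. -/
def rngLang : FirstOrder.Language.{0, 0} where
  Functions := RngFunc
  Relations := fun _ => Empty

/-- Every (not necessarily unital) ring is a structure for `rngLang` in the standard way. -/
instance rngStructure (R : Type v) [NonUnitalRing R] : rngLang.Structure R where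
  funMap := fun {_} f => match f with
    | RngFunc.zero => fun _ => 0
    | RngFunc.neg => fun x => -(x 0)
    | RngFunc.add => fun x => x 0 + x 1
    | RngFunc.mul => fun x => x 0 * x 1
  RelMap := fun r => Empty.elim r

/-! ### Interpretations without parameters -/

/-- The assignment of `x i j` to the variable `(i, j)`: a `k`-tuple of `d`-tuples, seen as one
assignment of elements to variables. -/
def blocks {M : Type v} {k d : ℕ} (x : Fin k → Fin d → M) : Fin k × Fin d → M :=
  fun p => x p.1 p.2

/-- The syntactic data of a parameter-free, `dim`-dimensional interpretation of `L'`-structures in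
`L`-structures. -/
structure Interpretation (L L' : FirstOrder.Language.{0, 0}) where
  dim : ℕ
  /-- defines the tuples that represent an element -/
  dom : L.Formula (Fin dim)
  /-- says that two tuples represent the same element -/
  eqv : L.Formula (Fin 2 × Fin dim)
  /-- defines the graph of a function symbol; the last block of variables is the value -/
  func : ∀ {k : ℕ}, L'.Functions k → L.Formula (Fin (k + 1) × Fin dim)
  /-- defines a relation symbol -/
  rel : ∀ {k : ℕ}, L'.Relations k → L.Formula (Fin k × Fin dim)

namespace Interpretation

variable {L L' : FirstOrder.Language.{0, 0}} (I : Interpretation L L')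

/-- The set of tuples of elements of `M` that represent an element. -/
def Dom (M : Type v) [L.Structure M] : Type v :=
  {x : Fin I.dim → M // I.dom.Realize x}

/-- `f` is a coordinate map witnessing that the data `I` interpret the `L'`-structure `N` in the
`L`-structure `M`: it sends the tuples satisfying the domain formula onto `N`, and equality and
all the symbols of `L'` pull back along `f` to the relations defined by the given formulas. -/
structure IsCoordinateMap {M : Type v} {N : Type w} [L.Structure M] [L'.Structure N]
    (f : I.Dom M → N) : Prop where
  surjective : Function.Surjective f
  eqv_iff : ∀ x : Fin 2 → I.Dom M,
    I.eqv.Realize (blocks fun i => (x i).1) ↔ f (x 0) = f (x 1)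
  func_iff : ∀ {k : ℕ} (s : L'.Functions k) (x : Fin (k + 1) → I.Dom M),
    (I.func s).Realize (blocks fun i => (x i).1) ↔
      FirstOrder.Language.Structure.funMap s (fun i : Fin k => f (x i.castSucc)) = f (x (Fin.last k))
  rel_iff : ∀ {k : ℕ} (s : L'.Relations k) (x : Fin k → I.Dom M),
    (I.rel s).Realize (blocks fun i => (x i).1) ↔
      FirstOrder.Language.Structure.RelMap s (fun i : Fin k => f (x i))

end Interpretation

/-! ### The groups `S_κ(X)` and their quotients -/

section Groups

variable (X : Type u)

/-- The support of a permutation: the set of points that it moves. -/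
def supp {X : Type u} (g : Equiv.Perm X) : Set X := {x | g x ≠ x}

/-- `S_κ(X)`: the permutations of `X` whose support has fewer than `κ` elements (`κ` infinite). -/
def symLT {κ : Cardinal.{u}} (hκ : ℵ₀ ≤ κ) : Subgroup (Equiv.Perm X) where
  carrier := {g | #(supp g) < κ}
  one_mem' := by
    have h : supp (1 : Equiv.Perm X) = ∅ := by ext x; simp [supp]
    simpa [h] using aleph0_pos.trans_le hκ
  mul_mem' := by
    intro a b ha hb
    refine lt_of_le_of_lt ((mk_le_mk_of_subset ?_).trans (mk_union_le (supp a) (supp b)))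
      (add_lt_of_lt hκ ha hb)
    intro x hx
    by_contra h
    simp only [supp, Set.mem_union, Set.mem_ofPred_eq, not_or, not_not] at h hx
    exact hx (by rw [Equiv.Perm.mul_apply, h.2, h.1])
  inv_mem' := by
    intro a ha
    refine lt_of_le_of_lt (mk_le_mk_of_subset ?_) ha
    intro x hx h
    exact hx (by rw [Equiv.Perm.inv_eq_iff_eq]; exact h.symm)

theorem mem_symLT {κ : Cardinal.{u}} {hκ : ℵ₀ ≤ κ} {g : Equiv.Perm X} :
    g ∈ symLT X hκ ↔ #(supp g) < κ := Iff.rfl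

instance symLT_normal {κ : Cardinal.{u}} (hκ : ℵ₀ ≤ κ) : (symLT X hκ).Normal where
  conj_mem := by
    intro n hn g
    have h : supp (g * n * g⁻¹) ⊆ g '' supp n := by
      intro x hx
      refine ⟨g⁻¹ x, fun h => hx ?_, by simp⟩
      rw [Equiv.Perm.mul_apply, Equiv.Perm.mul_apply, h]
      simp
    exact lt_of_le_of_lt ((mk_le_mk_of_subset h).trans mk_image_le) hn

/-- The quotient group `S_l(X) / S_κ(X)`. -/
abbrev SymQuot {κ l : Cardinal.{u}} (hκ : ℵ₀ ≤ κ) (hl : κ < l) : Type u :=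
  symLT X (hκ.trans hl.le) ⧸ (symLT X hκ).subgroupOf (symLT X (hκ.trans hl.le))

end Groups

/-! ### The rings of sets `P_κ(X)` and their quotients

In the Boolean ring `AsBoolRing (Set X)` addition is symmetric difference and multiplication is
intersection. -/

section Rings

variable (X : Type u)

/-- `P_κ(X)`: the ring of subsets of `X` with fewer than `κ` elements (`κ` infinite). -/
def setsLT {κ : Cardinal.{u}} (hκ : ℵ₀ ≤ κ) : NonUnitalSubring (AsBoolRing (Set X)) where
  carrier := {A | #(ofBoolRing A : Set X) < κ}
  zero_mem' := by simpa using aleph0_pos.trans_le hκ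
  add_mem' := by
    intro a b ha hb
    refine lt_of_le_of_lt ((mk_le_mk_of_subset ?_).trans
      (mk_union_le (ofBoolRing a : Set X) (ofBoolRing b))) (add_lt_of_lt hκ ha hb)
    rw [ofBoolRing_add]
    exact symmDiff_le_sup
  neg_mem' := by
    intro a ha
    simpa using ha
  mul_mem' := by
    intro a b ha _
    refine lt_of_le_of_lt (mk_le_mk_of_subset ?_) ha
    rw [ofBoolRing_mul]
    exact inf_le_left

theorem mem_setsLT {κ : Cardinal.{u}} {hκ : ℵ₀ ≤ κ} {A : AsBoolRing (Set X)} :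
    A ∈ setsLT X hκ ↔ #(ofBoolRing A : Set X) < κ := Iff.rfl

/-- `P_κ(X)` as an ideal of the ring `P_l(X)`. -/
def smallIdeal {κ l : Cardinal.{u}} (hκ : ℵ₀ ≤ κ) (hl : κ < l) :
    TwoSidedIdeal (setsLT X (hκ.trans hl.le)) :=
  TwoSidedIdeal.mk' {A | (A : AsBoolRing (Set X)) ∈ setsLT X hκ}
    (setsLT X hκ).zero_mem
    (fun ha hb => (setsLT X hκ).add_mem ha hb)
    (fun ha => (setsLT X hκ).neg_mem ha)
    (fun {a b} hb => by
      have h : #(ofBoolRing (a.1 * b.1) : Set X) < κ :=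
        lt_of_le_of_lt (mk_le_mk_of_subset (t := ofBoolRing b.1) inf_le_right) hb
      exact h)
    (fun {a b} ha => by
      have h : #(ofBoolRing (a.1 * b.1) : Set X) < κ :=
        lt_of_le_of_lt (mk_le_mk_of_subset (t := ofBoolRing a.1) inf_le_left) ha
      exact h)

theorem mem_smallIdeal {κ l : Cardinal.{u}} {hκ : ℵ₀ ≤ κ} {hl : κ < l}
    {A : setsLT X (hκ.trans hl.le)} :
    A ∈ smallIdeal X hκ hl ↔ #(ofBoolRing A.1 : Set X) < κ := by
  unfold smallIdeal
  exact TwoSidedIdeal.mem_mk' _ _ _ _ _ _ _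

/-- The quotient ring `P_l(X) / P_κ(X)`. -/
abbrev SetQuot {κ l : Cardinal.{u}} (hκ : ℵ₀ ≤ κ) (hl : κ < l) : Type u :=
  (smallIdeal X hκ hl).ringCon.Quotient

variable {X}

/-- The class in `P_l(X) / P_κ(X)` of a set with fewer than `l` elements. -/
def setClass {κ l : Cardinal.{u}} (hκ : ℵ₀ ≤ κ) (hl : κ < l) (A : Set X) (hA : #A < l) :
    SetQuot X hκ hl :=
  RingCon.toQuotient (⟨toBoolRing A, (mem_setsLT X).2 hA⟩ : setsLT X (hκ.trans hl.le))

theorem setClass_eq_iff {κ l : Cardinal.{u}} (hκ : ℵ₀ ≤ κ) (hl : κ < l) {A B : Set X}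
    (hA : #A < l) (hB : #B < l) :
    setClass hκ hl A hA = setClass hκ hl B hB ↔ #(symmDiff A B : Set X) < κ := by
  unfold setClass
  rw [RingCon.eq, TwoSidedIdeal.rel_iff, mem_smallIdeal]
  exact Iff.rfl

end Rings

/-! ### The natural action -/

section Action

variable {X : Type u}

/-- A permutation `g` acts on `P_l(X)` by taking images, `A ↦ g '' A`. -/
def imageAut {l : Cardinal.{u}} (hl : ℵ₀ ≤ l) (g : Equiv.Perm X) : RingAut (setsLT X hl) where
  toFun A := ⟨toBoolRing (g '' ofBoolRing A.1), mk_image_le.trans_lt A.2⟩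
  invFun A := ⟨toBoolRing (g.symm '' ofBoolRing A.1), mk_image_le.trans_lt A.2⟩
  left_inv A := Subtype.ext (by simp [← Set.image_comp])
  right_inv A := Subtype.ext (by simp [← Set.image_comp])
  map_mul' A B := Subtype.ext (Set.image_inter g.injective)
  map_add' A B := Subtype.ext (Set.image_symmDiff g.injective _ _)

theorem smallIdeal_eq_comap {κ l : Cardinal.{u}} (hκ : ℵ₀ ≤ κ) (hl : κ < l) (g : Equiv.Perm X) :
    (smallIdeal X hκ hl).ringCon =
      (smallIdeal X hκ hl).ringCon.comap (imageAut (hκ.trans hl.le) g) := by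
  ext A B
  rw [RingCon.comap_rel, TwoSidedIdeal.rel_iff, TwoSidedIdeal.rel_iff, ← map_sub,
    mem_smallIdeal, mem_smallIdeal]
  change #(ofBoolRing (A - B).1 : Set X) < κ ↔ #(g '' (ofBoolRing (A - B).1 : Set X) : Set X) < κ
  rw [mk_image_eq g.injective]

/-- The automorphism of `P_l(X) / P_κ(X)` that a permutation `g` induces by taking images. -/
def quotAut {κ l : Cardinal.{u}} (hκ : ℵ₀ ≤ κ) (hl : κ < l) (g : Equiv.Perm X) :
    RingAut (SetQuot X hκ hl) where
  __ := Quotient.congr (imageAut (hκ.trans hl.le) g).toEquiv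
    (RingCon.ext_iff.mp (smallIdeal_eq_comap hκ hl g))
  map_mul' := by
    rintro ⟨A⟩ ⟨B⟩
    exact congrArg RingCon.toQuotient (map_mul (imageAut (hκ.trans hl.le) g) A B)
  map_add' := by
    rintro ⟨A⟩ ⟨B⟩
    exact congrArg RingCon.toQuotient (map_add (imageAut (hκ.trans hl.le) g) A B)

theorem quotAut_setClass {κ l : Cardinal.{u}} (hκ : ℵ₀ ≤ κ) (hl : κ < l) (g : Equiv.Perm X)
    (A : Set X) (hA : #A < l) :
    quotAut hκ hl g (setClass hκ hl A hA) =
      setClass hκ hl (g '' A) (mk_image_le.trans_lt hA) := rfl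

theorem exists_setClass {κ l : Cardinal.{u}} (hκ : ℵ₀ ≤ κ) (hl : κ < l) (a : SetQuot X hκ hl) :
    ∃ (A : Set X) (hA : #A < l), setClass hκ hl A hA = a := by
  obtain ⟨A, rfl⟩ := Quotient.exists_rep a
  exact ⟨ofBoolRing A.1, A.2, rfl⟩

/-- The action of `S_l(X)` on the ring `P_l(X) / P_κ(X)` by images of sets. -/
def symAction {κ l : Cardinal.{u}} (hκ : ℵ₀ ≤ κ) (hl : κ < l) :
    symLT X (hκ.trans hl.le) →* RingAut (SetQuot X hκ hl) where
  toFun g := quotAut hκ hl g.1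
  map_one' := by
    refine RingEquiv.ext fun a => ?_
    obtain ⟨A, hA, rfl⟩ := exists_setClass hκ hl a
    rw [quotAut_setClass]
    change _ = setClass hκ hl A hA
    rw [setClass_eq_iff]
    simpa using aleph0_pos.trans_le hκ
  map_mul' g h := by
    refine RingEquiv.ext fun a => ?_
    obtain ⟨A, hA, rfl⟩ := exists_setClass hκ hl a
    change setClass hκ hl ((g.1 * h.1) '' A) (mk_image_le.trans_lt hA) =
      setClass hκ hl (g.1 '' (h.1 '' A)) ((mk_image_le.trans mk_image_le).trans_lt hA)
    refine (setClass_eq_iff hκ hl _ _).2 ?_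
    rw [← Set.image_comp, ← Equiv.Perm.coe_mul]
    simpa using aleph0_pos.trans_le hκ

theorem symAction_eq_one {κ l : Cardinal.{u}} (hκ : ℵ₀ ≤ κ) (hl : κ < l)
    (g : symLT X (hκ.trans hl.le))
    (hg : g ∈ (symLT X hκ).subgroupOf (symLT X (hκ.trans hl.le))) :
    symAction hκ hl g = 1 := by
  refine RingEquiv.ext fun a => ?_
  obtain ⟨A, hA, rfl⟩ := exists_setClass hκ hl a
  refine (setClass_eq_iff hκ hl (mk_image_le.trans_lt hA) hA).2
    (lt_of_le_of_lt (mk_le_mk_of_subset ?_) (Subgroup.mem_subgroupOf.1 hg))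
  rintro y (⟨⟨x, hx, rfl⟩, hy⟩ | ⟨hy, hy'⟩) h
  · exact hy (by rw [g.1.injective h]; exact hx)
  · exact hy' ⟨y, hy, h⟩

/-- The natural action of the group `S_l(X) / S_κ(X)` on the ring `P_l(X) / P_κ(X)`: the class of
`g` sends the class of `A` to the class of `g '' A`. -/
def quotAction {κ l : Cardinal.{u}} (hκ : ℵ₀ ≤ κ) (hl : κ < l) :
    SymQuot X hκ hl →* RingAut (SetQuot X hκ hl) :=
  QuotientGroup.lift _ (symAction hκ hl) (symAction_eq_one hκ hl)

theorem quotAction_mk {κ l : Cardinal.{u}} (hκ : ℵ₀ ≤ κ) (hl : κ < l)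
    (g : symLT X (hκ.trans hl.le)) (A : Set X) (hA : #A < l) :
    quotAction hκ hl (QuotientGroup.mk g) (setClass hκ hl A hA) =
      setClass hκ hl (g.1 '' A) (mk_image_le.trans_lt hA) := rfl

end Action

end QuotSym

open scoped commutatorElement
namespace QuotSym

/-! ### Permutations modulo small sets -/

section Perms

variable {X : Type u} {κ : Cardinal.{u}}

/-! The class of a set is coded by a group element with trivial fifth power that has this set as
support modulo small sets. The point is to define disjointness of supports in the group; this is
`AlgDisj`, and `algDisj_iff` proves that it works.

If `t` and `g` are disjoint and `h` does not commute with `t`, then `h` maps some large `V` inside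
the support of `t` off itself. For `p`, `q` supported in `V`, the commutator `⁅⁅h, p⁆, q⁆` reduces
to `⁅p⁻¹, q⁆`, which can be made nontrivial and commutes with `g`. Conversely, let the supports
overlap in a large set. Take `h` with support `A` in the overlap, where `t` maps `A` off itself and
`A` meets each 5-cycle of `g` at most once. The support of `⁅⁅h, p⁆, q⁆` is covered by four
translates of `A` under permutations commuting with `g`. If this commutator commuted with `g` and
were nontrivial, its support would contain a whole 5-cycle, two points of which would lie in the
same translate: impossible. Hence the exponent five.

In a Boolean ring, disjointness determines the order, hence the product as an infimum, and also the
sum. The action is conjugation, since it moves supports by images. -/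

/-- The filter of sets whose complement has fewer than `κ` elements. -/
def cosmall (X : Type u) {κ : Cardinal.{u}} (hκ : ℵ₀ ≤ κ) : Filter X where
  sets := {s | #(sᶜ : Set X) < κ}
  univ_sets := by simpa using aleph0_pos.trans_le hκ
  sets_of_superset {s t} hs hst :=
    (mk_le_mk_of_subset (Set.compl_subset_compl.2 hst)).trans_lt hs
  inter_sets {s t} hs ht := by
    change #((s ∩ t)ᶜ : Set X) < κ
    rw [Set.compl_inter]
    exact (mk_union_le _ _).trans_lt (add_lt_of_lt hκ hs ht)

theorem eventually_cosmall {hκ : ℵ₀ ≤ κ} {p : X → Prop} :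
    (∀ᶠ x in cosmall X hκ, p x) ↔ #{x | ¬ p x} < κ := Iff.rfl

theorem frequently_cosmall {hκ : ℵ₀ ≤ κ} {p : X → Prop} :
    (∃ᶠ x in cosmall X hκ, p x) ↔ κ ≤ #{x | p x} := by
  rw [Filter.Frequently, eventually_cosmall, not_lt]
  simp only [not_not]

theorem tendsto_perm (hκ : ℵ₀ ≤ κ) (p : Equiv.Perm X) :
    Filter.Tendsto p (cosmall X hκ) (cosmall X hκ) := by
  intro s hs
  refine (mk_preimage_of_injective p sᶜ p.injective).trans_lt ?_
  exact hs

/-- A large set of points moved by `p` has a large subset that `p` maps off itself. -/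
theorem exists_large_disjoint_image (hκ : ℵ₀ ≤ κ) (p : Equiv.Perm X) {Y : Set X} (hY : κ ≤ #Y)
    (hp : ∀ x ∈ Y, p x ≠ x) : ∃ V ⊆ Y, κ ≤ #V ∧ ∀ x ∈ V, p x ∉ V := by
  obtain ⟨V, hV⟩ := zorn_subset {V : Set X | V ⊆ Y ∧ ∀ x ∈ V, p x ∉ V} (by
    intro c hc hchain
    refine ⟨⋃₀ c, ⟨Set.sUnion_subset fun s hs => (hc hs).1, ?_⟩, fun s => Set.subset_sUnion_of_mem⟩
    rintro x ⟨s, hs, hxs⟩ ⟨t, ht, hxt⟩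
    rcases hchain.total hs ht with h | h
    · exact (hc ht).2 x (h hxs) hxt
    · exact (hc hs).2 x hxs (h hxt))
  refine ⟨V, hV.prop.1, ?_, hV.prop.2⟩
  by_contra hlt
  rw [not_le] at hlt
  -- A point of `Y` outside these three sets could be added to the maximal `V`. So if `V` were
  -- small, `Y` would be too.
  have hsub : Y ⊆ V ∪ (p ⁻¹' V ∪ p.symm ⁻¹' V) := by
    intro y hy
    by_contra hn
    simp only [Set.mem_union, Set.mem_preimage, not_or] at hn
    obtain ⟨h1, h2, h3⟩ := hn
    refine h1 (hV.le_of_ge (y := insert y V) ⟨Set.insert_subset hy hV.prop.1, ?_⟩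
      (Set.subset_insert y V) (Set.mem_insert y V))
    rintro x (rfl | hx) (h | h)
    · exact hp _ hy h
    · exact h2 h
    · exact h3 (by rw [← h]; simpa using hx)
    · exact hV.prop.2 x hx h
  refine absurd hY (not_le.2 ((mk_le_mk_of_subset hsub).trans_lt ?_))
  refine (mk_union_le _ _).trans_lt (add_lt_of_lt hκ hlt ?_)
  exact (mk_union_le _ _).trans_lt (add_lt_of_lt hκ
    ((mk_preimage_of_injective p V p.injective).trans_lt hlt)
    ((mk_preimage_of_injective p.symm V p.symm.injective).trans_lt hlt))

/-- A large set contains a large subset mapped off itself by each of finitely many permutations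
without fixed points in the given set. -/
theorem exists_large_disjoint_images (hκ : ℵ₀ ≤ κ) (ps : List (Equiv.Perm X)) {Y : Set X}
    (hY : κ ≤ #Y) (hp : ∀ p ∈ ps, ∀ x ∈ Y, p x ≠ x) :
    ∃ V ⊆ Y, κ ≤ #V ∧ ∀ p ∈ ps, ∀ x ∈ V, p x ∉ V := by
  induction ps with
  | nil => exact ⟨Y, subset_rfl, hY, by simp⟩
  | cons p ps ih =>
    obtain ⟨V, hVY, hV, h⟩ := ih fun q hq => hp q (List.mem_cons_of_mem p hq)
    obtain ⟨W, hWV, hW, h'⟩ := exists_large_disjoint_image hκ p hV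
      fun x hx => hp p List.mem_cons_self x (hVY hx)
    refine ⟨W, hWV.trans hVY, hW, fun q hq x hx => ?_⟩
    rcases List.mem_cons.1 hq with rfl | hq
    · exact h' x hx
    · exact fun hn => h q hq x (hWV hx) (hWV hn)

/-- The symmetric group on `n > 0` points acts on any infinite set `V`, by permutations supported
in `V`, so that a permutation without fixed points moves every point of `V`. -/
theorem exists_perm_hom (V : Set X) (hV : ℵ₀ ≤ #V) (n : ℕ) (hn : n ≠ 0) :
    ∃ φ : Equiv.Perm (Fin n) →* Equiv.Perm X,
      (∀ s, supp (φ s) ⊆ V) ∧ ∀ s, (∀ i, s i ≠ i) → supp (φ s) = V := by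
  classical
  -- An infinite `V` splits into copies of `Fin n`, on each of which the symmetric group acts.
  have : Nonempty (V ≃ V × Fin n) := by
    rw [← Cardinal.eq, mk_prod, mk_fin, lift_uzero, lift_natCast]
    exact (mul_eq_left hV ((natCast_lt_aleph0).le.trans hV) (by exact_mod_cast hn)).symm
  obtain ⟨e⟩ := this
  let ψ : Equiv.Perm (Fin n) →* Equiv.Perm V :=
    { toFun := fun s => e.trans ((Equiv.prodCongr (Equiv.refl V) s).trans e.symm)
      map_one' := by ext x; simp
      map_mul' := fun s t => by ext x; simp [Prod.map] }
  have hsub : ∀ s, supp (Equiv.Perm.ofSubtype (ψ s)) ⊆ V := by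
    intro s x hx
    by_contra h
    exact hx (Equiv.Perm.ofSubtype_apply_of_not_mem (ψ s) h)
  refine ⟨Equiv.Perm.ofSubtype.comp ψ, hsub, fun s hs => (hsub s).antisymm fun x hx h => ?_⟩
  replace h := (Equiv.Perm.ofSubtype_apply_of_mem (ψ s) hx).symm.trans h
  have h2 : ψ s ⟨x, hx⟩ = ⟨x, hx⟩ := Subtype.ext h
  have h3 := congrArg (fun y => (e y).2) h2
  exact hs _ (by simpa [ψ] using h3)

theorem exists_order_five (V : Set X) (hV : ℵ₀ ≤ #V) :
    ∃ p : Equiv.Perm X, p ^ 5 = 1 ∧ supp p = V := by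
  obtain ⟨φ, -, h⟩ := exists_perm_hom V hV 5 (by decide)
  refine ⟨φ (finRotate 5), ?_, h _ (by decide)⟩
  rw [← map_pow, show finRotate 5 ^ 5 = 1 by decide, map_one]

/-- In the symmetric group on three points, the commutator of two distinct transpositions is a
3-cycle, which has no fixed point. -/
theorem exists_commutator (V : Set X) (hV : ℵ₀ ≤ #V) :
    ∃ p q : Equiv.Perm X, supp p ⊆ V ∧ supp q ⊆ V ∧ supp ⁅p⁻¹, q⁆ = V := by
  obtain ⟨φ, h, h'⟩ := exists_perm_hom V hV 3 (by decide)
  refine ⟨φ (Equiv.swap 0 1), φ (Equiv.swap 1 2), h _, h _, ?_⟩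
  rw [← map_inv, ← map_commutatorElement]
  exact h' _ (by rw [commutatorElement_def]; decide)

theorem commute_of_disjoint_supp {p q : Equiv.Perm X} (h : Disjoint (supp p) (supp q)) :
    Commute p q := by
  refine Equiv.Perm.Disjoint.commute fun x => ?_
  by_contra! hx
  exact Set.disjoint_left.1 h hx.1 hx.2

theorem supp_inv (p : Equiv.Perm X) : supp p⁻¹ = supp p := by
  ext x
  exact not_congr (Equiv.Perm.inv_eq_iff_eq.trans eq_comm)

theorem supp_conj (p q : Equiv.Perm X) : supp (p * q * p⁻¹) = p '' supp q := by
  ext x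
  rw [Equiv.image_eq_preimage_symm]
  exact not_congr (Equiv.Perm.eq_inv_iff_eq (f := p) (x := q (p.symm x)) (y := x)).symm

/-- The commutator is `p` times a conjugate of `p⁻¹` by `q`. -/
theorem supp_commutator_subset (p q : Equiv.Perm X) :
    supp ⁅p, q⁆ ⊆ supp p ∪ (q⁻¹ : Equiv.Perm X) ⁻¹' supp p := by
  intro x hx
  by_contra hn
  simp only [Set.mem_union, Set.mem_preimage, not_or] at hn
  obtain ⟨h1, h2⟩ := hn
  rw [← supp_inv] at h2
  have h1 := not_not.1 h1
  have h2 := not_not.1 h2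
  apply hx
  rw [commutatorElement_def, Equiv.Perm.mul_apply, Equiv.Perm.mul_apply, Equiv.Perm.mul_apply, h2]
  exact (congrArg p (q.apply_symm_apply x)).trans h1

end Perms

/-! ### Algebraic disjointness -/

/-- `t` is algebraically disjoint from `g`: every `h` that does not commute with `t` has a
nontrivial iterated commutator with elements of the centralizer of `g` that lies in this
centralizer itself. -/
def AlgDisj {G : Type v} [Group G] (t g : G) : Prop :=
  ∀ h : G, h * t ≠ t * h → ∃ p q : G, p * g = g * p ∧ q * g = g * q ∧
    ⁅⁅h, p⁆, q⁆ * g = g * ⁅⁅h, p⁆, q⁆ ∧ ⁅⁅h, p⁆, q⁆ ≠ 1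

theorem commutator_mul_left_of_commute {G : Type v} [Group G] {a p q : G} (hp : Commute a p)
    (hq : Commute a q) : ⁅a * p, q⁆ = ⁅p, q⁆ := by
  have h : Commute a (p * q * p⁻¹) := (hp.mul_right hq).mul_right hp.inv_right
  calc ⁅a * p, q⁆ = a * (p * q * p⁻¹) * a⁻¹ * q⁻¹ := by
        rw [commutatorElement_def]; group
    _ = ⁅p, q⁆ := by rw [h.eq, mul_inv_cancel_right, commutatorElement_def]

/-! ### Disjointness of supports modulo small sets. -/

section Quotients

variable {X : Type u} {κ l : Cardinal.{u}} (hκ : ℵ₀ ≤ κ) (hl : κ < l)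

theorem symQuot_mk_eq_iff {g h : symLT X (hκ.trans hl.le)} :
    (QuotientGroup.mk g : SymQuot X hκ hl) = QuotientGroup.mk h ↔
      ∀ᶠ x in cosmall X hκ, g.1 x = h.1 x := by
  rw [QuotientGroup.eq, Subgroup.mem_subgroupOf, mem_symLT, eventually_cosmall]
  have : supp ((g⁻¹ * h : symLT X (hκ.trans hl.le)) : Equiv.Perm X) = {x | ¬ g.1 x = h.1 x} := by
    ext x
    exact not_congr ((Equiv.Perm.inv_eq_iff_eq (f := g.1)).trans eq_comm)
  rw [this]

theorem symQuot_commute_iff {g h : symLT X (hκ.trans hl.le)} :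
    Commute (QuotientGroup.mk g : SymQuot X hκ hl) (QuotientGroup.mk h) ↔
      ∀ᶠ x in cosmall X hκ, g.1 (h.1 x) = h.1 (g.1 x) :=
  symQuot_mk_eq_iff hκ hl (g := g * h) (h := h * g)

theorem symQuot_mk_ne_one_iff {g : symLT X (hκ.trans hl.le)} :
    (QuotientGroup.mk g : SymQuot X hκ hl) ≠ 1 ↔ ∃ᶠ x in cosmall X hκ, g.1 x ≠ x :=
  (not_congr (symQuot_mk_eq_iff hκ hl (g := g) (h := 1))).trans Filter.not_eventually

/-- Permutations with disjoint supports commute. Here disjointness fails on a small set, so it is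
required at `x`, `h x` and `t x`; permutations preserve smallness. -/
theorem frequently_moved_of_not_commute {h t : symLT X (hκ.trans hl.le)}
    (hht : ¬ Commute (QuotientGroup.mk h : SymQuot X hκ hl) (QuotientGroup.mk t)) :
    ∃ᶠ x in cosmall X hκ, h.1 x ≠ x ∧ t.1 x ≠ x := by
  intro hn
  refine hht ((symQuot_commute_iff hκ hl).2 ?_)
  filter_upwards [hn, (tendsto_perm hκ h.1).eventually hn, (tendsto_perm hκ t.1).eventually hn]
    with x h1 h2 h3
  by_cases hx : h.1 x = x
  · by_cases hx' : t.1 x = x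
    · simp [hx, hx']
    · rw [hx]
      by_contra h4
      exact h3 ⟨h4, fun h5 => hx' (t.1.injective h5)⟩
  · have hx' : t.1 x = x := by
      by_contra h4
      exact h1 ⟨hx, h4⟩
    rw [hx']
    by_contra h4
    exact h2 ⟨fun h5 => hx (h.1.injective h5), fun h5 => h4 h5.symm⟩

theorem algDisj_of_disjoint {t g : symLT X (hκ.trans hl.le)}
    (hd : ∀ᶠ x in cosmall X hκ, ¬ (t.1 x ≠ x ∧ g.1 x ≠ x)) :
    AlgDisj (QuotientGroup.mk t : SymQuot X hκ hl) (QuotientGroup.mk g) := by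
  intro h hht
  induction h using QuotientGroup.induction_on with | _ h =>
  have hY := (frequently_moved_of_not_commute hκ hl hht).and_eventually hd
  rw [frequently_cosmall] at hY
  -- `V` consists of points moved by `h` and `t` but not by `g`, and `h` maps it off itself.
  obtain ⟨V, hVY, hV, hhV⟩ := exists_large_disjoint_image hκ h.1 hY fun x hx => hx.1.1
  obtain ⟨p, q, hp, hq, hpq⟩ := exists_commutator V (hκ.trans hV)
  have hVl : #V < l :=
    (mk_le_mk_of_subset fun x hx => (hVY hx).1.2 : #V ≤ #(supp t.1)).trans_lt t.2
  have hVg : Disjoint V (supp g.1) :=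
    Set.disjoint_left.2 fun x hx hxg => (hVY hx).2 ⟨(hVY hx).1.2, hxg⟩
  let p' : symLT X (hκ.trans hl.le) := ⟨p, (mk_le_mk_of_subset hp).trans_lt hVl⟩
  let q' : symLT X (hκ.trans hl.le) := ⟨q, (mk_le_mk_of_subset hq).trans_lt hVl⟩
  have hconj : Disjoint (supp (h.1 * p * h.1⁻¹)) V := by
    rw [supp_conj]
    refine Set.disjoint_left.2 ?_
    rintro _ ⟨x, hx, rfl⟩ hx'
    exact hhV x (hp hx) hx'
  -- In `⁅h, p⁆ = (h * p * h⁻¹) * p⁻¹` the first factor is supported off `V`, so it commutes with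
  -- `p⁻¹` and `q` and drops out.
  have hcomm : ⁅⁅h.1, p⁆, q⁆ = ⁅p⁻¹, q⁆ := by
    rw [commutatorElement_def h.1 p]
    exact commutator_mul_left_of_commute
      (commute_of_disjoint_supp (hconj.mono_right ((supp_inv p).trans_subset hp)))
      (commute_of_disjoint_supp (hconj.mono_right hq))
  have key : ∀ r : symLT X (hκ.trans hl.le), supp r.1 ⊆ V →
      (QuotientGroup.mk r : SymQuot X hκ hl) * QuotientGroup.mk g =
        QuotientGroup.mk g * QuotientGroup.mk r := fun r hr =>
    congrArg QuotientGroup.mk (Subtype.ext (commute_of_disjoint_supp (hVg.mono_left hr)).eq :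
      r * g = g * r)
  have hsupp : supp (⁅⁅h, p'⁆, q'⁆ : symLT X (hκ.trans hl.le)).1 = V :=
    (congrArg supp hcomm).trans hpq
  refine ⟨QuotientGroup.mk p', QuotientGroup.mk q', key p' hp, key q' hq,
    key ⁅⁅h, p'⁆, q'⁆ hsupp.subset, ?_⟩
  refine (symQuot_mk_ne_one_iff hκ hl (g := ⁅⁅h, p'⁆, q'⁆)).2 (frequently_cosmall.2 ?_)
  change κ ≤ #(supp (⁅⁅h, p'⁆, q'⁆ : symLT X (hκ.trans hl.le)).1)
  rwa [hsupp]

/-- A point with periods `m` and 5 has period `gcd m 5 = 1`. -/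
theorem pow_apply_ne_of_pow_five {g : Equiv.Perm X} {x : X} (h5 : (g ^ 5) x = x) (hx : g x ≠ x)
    {m : ℕ} (h0 : 0 < m) (hm : m < 5) : (g ^ m) x ≠ x := by
  intro h
  rw [← Equiv.Perm.iterate_eq_pow] at h h5
  have h1 := Function.IsPeriodicPt.gcd (f := g) h h5
  have h2 : m.gcd 5 = 1 := by interval_cases m <;> rfl
  rw [h2] at h1
  exact hx h1

/-- Two uses of `supp_commutator_subset` give four words. That there are fewer than five is what
`disjoint_of_algDisj` needs. -/
theorem supp_iterated_commutator_subset (h p q : Equiv.Perm X) :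
    supp ⁅⁅h, p⁆, q⁆ ⊆
      {x | ∃ j : Fin 4, (![1, p⁻¹, q⁻¹, p⁻¹ * q⁻¹] j : Equiv.Perm X) x ∈ supp h} := by
  intro x hx
  rcases supp_commutator_subset _ _ hx with h1 | h1 <;>
    rcases supp_commutator_subset _ _ h1 with h2 | h2
  exacts [⟨0, h2⟩, ⟨1, h2⟩, ⟨2, h2⟩, ⟨3, h2⟩]

theorem disjoint_of_algDisj {t g : symLT X (hκ.trans hl.le)}
    (hg : (QuotientGroup.mk g : SymQuot X hκ hl) ^ 5 = 1)
    (hd : AlgDisj (QuotientGroup.mk t : SymQuot X hκ hl) (QuotientGroup.mk g)) :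
    ∀ᶠ x in cosmall X hκ, ¬ (t.1 x ≠ x ∧ g.1 x ≠ x) := by
  by_contra hn
  have hg5 : ∀ᶠ x in cosmall X hκ, (g.1 ^ 5) x = x :=
    (symQuot_mk_eq_iff hκ hl (g := g ^ 5) (h := 1)).1 hg
  have hY := (Filter.not_eventually.1 hn).and_eventually hg5
  simp only [not_not] at hY
  rw [frequently_cosmall] at hY
  -- `A` is disjoint from its images under `t` and `g, …, g ^ 4`, so it has at most one point in
  -- each 5-cycle of `g`.
  obtain ⟨A, hAY, hA, hAd⟩ := exists_large_disjoint_images hκ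
    (t.1 :: (List.range 4).map fun m => g.1 ^ (m + 1)) hY (by
      intro p hp x hx
      rcases List.mem_cons.1 hp with rfl | hp
      · exact hx.1.1
      · obtain ⟨m, hm, rfl⟩ := List.mem_map.1 hp
        have := List.mem_range.1 hm
        exact pow_apply_ne_of_pow_five hx.2 hx.1.2 m.succ_pos (by omega))
  have hAt : ∀ x ∈ A, t.1 x ∉ A := hAd _ List.mem_cons_self
  have hAg : ∀ m, 0 < m → m < 5 → ∀ x ∈ A, (g.1 ^ m) x ∉ A := fun m h0 hm =>
    hAd _ (List.mem_cons_of_mem _ (List.mem_map.2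
      ⟨m - 1, List.mem_range.2 (by omega), by rw [Nat.sub_add_cancel h0]⟩))
  obtain ⟨h₀, -, hh₀⟩ := exists_order_five A (hκ.trans hA)
  let h : symLT X (hκ.trans hl.le) := ⟨h₀, (mk_le_mk_of_subset
    (hh₀.trans_subset fun x hx => (hAY hx).1.1 : supp h₀ ⊆ supp t.1)).trans_lt t.2⟩
  -- For `x` in `A`, `h` moves `x` but fixes `t x`, which lies off `A`.
  have hht : ¬ Commute (QuotientGroup.mk h : SymQuot X hκ hl) (QuotientGroup.mk t) := by
    refine (symQuot_commute_iff hκ hl).not.2 ?_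
    refine Filter.not_eventually.2 (frequently_cosmall.2
      (hA.trans (mk_le_mk_of_subset fun x hx => ?_)))
    intro he
    have h1 : h₀ (t.1 x) = t.1 x := by
      by_contra h2
      exact hAt x hx (hh₀ ▸ h2 : t.1 x ∈ A)
    have h2 : h₀ x ≠ x := (hh₀.symm ▸ hx : x ∈ supp h₀)
    exact h2 (t.1.injective (he.symm.trans h1))
  obtain ⟨p, q, hp, hq, hk, hk1⟩ := hd (QuotientGroup.mk h) hht
  induction p using QuotientGroup.induction_on with | _ p =>
  induction q using QuotientGroup.induction_on with | _ q =>
  let G := SymQuot X hκ hl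
  have hp : Commute (QuotientGroup.mk p : G) (QuotientGroup.mk g) := hp
  have hq : Commute (QuotientGroup.mk q : G) (QuotientGroup.mk g) := hq
  let k : symLT X (hκ.trans hl.le) := ⁅⁅h, p⁆, q⁆
  have hk : Commute (QuotientGroup.mk k : G) (QuotientGroup.mk g) := hk
  have hk1 : ∃ᶠ x in cosmall X hκ, k.1 x ≠ x := (symQuot_mk_ne_one_iff hκ hl (g := k)).1 hk1
  let w : Fin 4 → symLT X (hκ.trans hl.le) := ![1, p⁻¹, q⁻¹, p⁻¹ * q⁻¹]
  have hw : ∀ j, Commute (QuotientGroup.mk (w j) : G) (QuotientGroup.mk g) := by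
    intro j
    fin_cases j
    · exact Commute.one_left _
    · exact hp.inv_left
    · exact hq.inv_left
    · exact hp.inv_left.mul_left hq.inv_left
  have ev : ∀ r : symLT X (hκ.trans hl.le),
      Commute (QuotientGroup.mk r : G) (QuotientGroup.mk g) → ∀ i : Fin 5,
      ∀ᶠ x in cosmall X hκ, r.1 ((g.1 ^ (i : ℕ)) x) = (g.1 ^ (i : ℕ)) (r.1 x) := fun r hr i =>
    (symQuot_commute_iff hκ hl (g := r) (h := g ^ (i : ℕ))).1 (hr.pow_right (i : ℕ))
  -- A point moved by `k` at which all the commutation relations, valid only off small sets, hold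
  -- exactly.
  obtain ⟨b, ⟨hb, hbk⟩, hbw⟩ :=
    ((hk1.and_eventually (Filter.eventually_all.2 (ev k hk))).and_eventually (Filter.eventually_all.2 fun j => Filter.eventually_all.2 (ev (w j) (hw j)))).exists
  have hex : ∀ i : Fin 5, ∃ j : Fin 4, (g.1 ^ (i : ℕ)) ((w j).1 b) ∈ A := by
    intro i
    have h1 : (g.1 ^ (i : ℕ)) b ∈ supp ⁅⁅h₀, p.1⁆, q.1⁆ := by
      intro h2
      exact hb ((g.1 ^ (i : ℕ)).injective ((hbk i).symm.trans h2))
    obtain ⟨j, hj⟩ := supp_iterated_commutator_subset _ _ _ h1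
    refine ⟨j, ?_⟩
    rw [← hbw j i, ← hh₀]
    fin_cases j <;> exact hj
  choose j hj using hex
  -- Five powers of `g` and four words: two points of one `g`-orbit lie in `A`.
  obtain ⟨i, i', hne, heq⟩ := Fintype.exists_ne_map_eq_of_card_lt j (by simp)
  have main : ∀ (m n : ℕ) (c : X), m < n → n < 5 → (g.1 ^ m) c ∈ A → (g.1 ^ n) c ∈ A → False := by
    intro m n c hmn hn hm hn'
    obtain ⟨d, rfl⟩ := Nat.exists_eq_add_of_lt hmn
    refine hAg (d + 1) d.succ_pos (by omega) _ hm ?_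
    rw [← Equiv.Perm.mul_apply, ← pow_add]
    convert hn' using 3
    ring
  rcases lt_or_gt_of_ne hne with hlt | hlt
  · exact main i i' _ hlt i'.isLt (hj i) (heq ▸ hj i')
  · exact main i' i _ hlt i.isLt (hj i') (heq ▸ hj i)

/-! ### Supports as elements of the ring. -/

/-- The class of the support of an element of `S_l(X) / S_κ(X)`. -/
def suppClass (a : SymQuot X hκ hl) : SetQuot X hκ hl :=
  Quotient.liftOn' a (fun g => setClass hκ hl (supp g.1) g.2) (by
    intro g h hgh
    refine (setClass_eq_iff hκ hl g.2 h.2).2 ?_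
    have := (symQuot_mk_eq_iff hκ hl).1 (Quotient.sound' hgh)
    refine (mk_le_mk_of_subset ?_).trans_lt (eventually_cosmall.1 this)
    rintro x (⟨h1, h2⟩ | ⟨h1, h2⟩) he
    · exact h1 (he.trans (not_not.1 h2))
    · exact h1 (he.symm.trans (not_not.1 h2)))

theorem setClass_congr {A B : Set X} (hA : #A < l) (hB : #B < l) (h : A = B) :
    setClass hκ hl A hA = setClass hκ hl B hB := by
  subst h
  rfl

theorem setClass_eq_zero_iff {A : Set X} (hA : #A < l) : setClass hκ hl A hA = 0 ↔ #A < κ := by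
  have h : #(∅ : Set X) < l := by simpa using aleph0_pos.trans_le (hκ.trans hl.le)
  change setClass hκ hl A hA = setClass hκ hl ∅ h ↔ _
  rw [setClass_eq_iff, ← Set.bot_eq_empty, symmDiff_bot]

theorem algDisj_iff {t g : SymQuot X hκ hl} (hg : g ^ 5 = 1) :
    AlgDisj t g ↔ suppClass hκ hl t * suppClass hκ hl g = 0 := by
  induction t using QuotientGroup.induction_on with | _ t =>
  induction g using QuotientGroup.induction_on with | _ g =>
  have h : suppClass hκ hl (QuotientGroup.mk t) * suppClass hκ hl (QuotientGroup.mk g) =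
      setClass hκ hl (supp t.1 ∩ supp g.1)
        ((mk_le_mk_of_subset Set.inter_subset_left).trans_lt t.2) := rfl
  have h' : #(supp t.1 ∩ supp g.1 : Set X) < κ ↔
      ∀ᶠ x in cosmall X hκ, ¬ (t.1 x ≠ x ∧ g.1 x ≠ x) := by
    rw [eventually_cosmall]
    simp only [not_not]
    rfl
  rw [h, setClass_eq_zero_iff, h']
  exact ⟨disjoint_of_algDisj hκ hl hg, algDisj_of_disjoint hκ hl⟩

theorem suppClass_conj (g a : SymQuot X hκ hl) :
    suppClass hκ hl (g * a * g⁻¹) = quotAction hκ hl g (suppClass hκ hl a) := by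
  induction g using QuotientGroup.induction_on with | _ g =>
  induction a using QuotientGroup.induction_on with | _ a =>
  exact setClass_congr hκ hl (g * a * g⁻¹).2 (mk_image_le.trans_lt a.2) (supp_conj g.1 a.1)

theorem exists_suppClass_eq (r : SetQuot X hκ hl) :
    ∃ a : SymQuot X hκ hl, a ^ 5 = 1 ∧ suppClass hκ hl a = r := by
  obtain ⟨A, hA, rfl⟩ := exists_setClass hκ hl r
  -- A small `A` may be finite and carry no suitable permutation, but its class is zero and the
  -- identity represents it.
  rcases lt_or_ge #A κ with h | h
  · refine ⟨1, one_pow 5, ?_⟩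
    rw [(setClass_eq_zero_iff hκ hl hA).2 h]
    exact (setClass_eq_zero_iff hκ hl (symLT X (hκ.trans hl.le)).one_mem).2 (symLT X hκ).one_mem
  · obtain ⟨p, hp, hs⟩ := exists_order_five A (hκ.trans h)
    let p' : symLT X (hκ.trans hl.le) := ⟨p, (congrArg (fun s : Set X => #s) hs).trans_lt hA⟩
    refine ⟨QuotientGroup.mk p', congrArg QuotientGroup.mk (Subtype.ext hp : p' ^ 5 = 1), ?_⟩
    exact setClass_congr hκ hl p'.2 hA hs

end Quotients

/-! ### Boolean rings without unit -/

section BooleanRng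

variable {R : Type w} [NonUnitalRing R]

theorem add_self_of_mul_self (hR : ∀ x : R, x * x = x) (x : R) : x + x = 0 := by
  have h := hR (x + x)
  rw [mul_add, add_mul, hR] at h
  exact left_eq_add.1 h.symm

theorem neg_eq_of_mul_self (hR : ∀ x : R, x * x = x) (x : R) : -x = x :=
  neg_eq_of_add_eq_zero_left (add_self_of_mul_self hR x)

theorem mul_comm_of_mul_self (hR : ∀ x : R, x * x = x) (x y : R) : x * y = y * x := by
  have h := hR (x + y)
  rw [mul_add, add_mul, add_mul, hR, hR] at h
  have h' : y * x + x * y = 0 := by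
    have : x + y + (y * x + x * y) = x + y := by
      convert h using 1; abel
    exact left_eq_add.1 this.symm
  rw [← neg_eq_of_mul_self hR (x * y)]
  exact (eq_neg_of_add_eq_zero_left h').symm

/-- Without a unit, the relative complement `a - a * b` serves as the test element. -/
theorem mul_eq_left_iff_of_mul_self (hR : ∀ x : R, x * x = x) (a b : R) :
    a * b = a ↔ ∀ r : R, r * b = 0 → r * a = 0 := by
  refine ⟨fun h r hr => ?_, fun h => ?_⟩
  · rw [← h, mul_comm_of_mul_self hR a, ← mul_assoc, hr, zero_mul]
  · have h1 := h (a - a * b) (by rw [sub_mul, mul_assoc, hR, sub_self])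
    rw [sub_mul, hR, mul_assoc, mul_comm_of_mul_self hR b, ← mul_assoc, hR] at h1
    exact (sub_eq_zero.1 h1).symm

theorem eq_iff_mul_of_mul_self (hR : ∀ x : R, x * x = x) (a b : R) :
    a = b ↔ a * b = a ∧ b * a = b := by
  refine ⟨?_, fun ⟨h1, h2⟩ => ?_⟩
  · rintro rfl
    exact ⟨hR a, hR a⟩
  · rw [← h1, mul_comm_of_mul_self hR, h2]

/-- The product is the greatest lower bound for the order `x * y = x`. -/
theorem mul_eq_iff_of_mul_self (hR : ∀ x : R, x * x = x) (a b c : R) :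
    a * b = c ↔ c * a = c ∧ c * b = c ∧ ∀ r : R, r * a = r → r * b = r → r * c = r := by
  refine ⟨?_, fun ⟨h1, h2, h3⟩ => ?_⟩
  · rintro rfl
    refine ⟨?_, by rw [mul_assoc, hR], fun r h1 h2 => by rw [← mul_assoc, h1, h2]⟩
    rw [mul_comm_of_mul_self hR, ← mul_assoc, hR]
  · rw [← h3 (a * b) (by rw [mul_comm_of_mul_self hR, ← mul_assoc, hR]) (by rw [mul_assoc, hR]),
      mul_comm_of_mul_self hR, ← mul_assoc, h1, h2]

theorem mul_add_eq_zero_iff_of_mul_self (hR : ∀ x : R, x * x = x) (a b k : R) :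
    k * (a + b) = 0 ↔ ∀ m : R, m * k = m → (m * a = 0 ↔ m * b = 0) := by
  rw [mul_add]
  refine ⟨fun h m hm => ?_, fun h => ?_⟩
  · have h1 : k * a = k * b := by
      rw [← neg_eq_of_mul_self hR (k * b)]
      exact eq_neg_of_add_eq_zero_left h
    rw [← hm, mul_assoc, mul_assoc, h1]
  · have key : ∀ a b : R, (∀ m : R, m * k = m → m * b = 0 → m * a = 0) → k * a = k * (a * b) := by
      intro a b h
      have hk : (k * (a - a * b)) * k = k * (a - a * b) := by
        rw [mul_comm_of_mul_self hR, ← mul_assoc, hR]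
      have h1 := h (k * (a - a * b)) hk (by
        rw [mul_assoc, sub_mul, mul_assoc, hR, sub_self, mul_zero])
      rw [mul_assoc, sub_mul, hR, mul_assoc, mul_comm_of_mul_self hR b, ← mul_assoc, hR,
        mul_sub] at h1
      exact sub_eq_zero.1 h1
    rw [key a b fun m hm => (h m hm).2, key b a fun m hm => (h m hm).1, mul_comm_of_mul_self hR b a]
    exact add_self_of_mul_self hR _

/-- An element is determined by its annihilator. -/
theorem add_eq_iff_of_mul_self (hR : ∀ x : R, x * x = x) (a b c : R) :
    a + b = c ↔ ∀ k : R, k * c = 0 ↔ ∀ m : R, m * k = m → (m * a = 0 ↔ m * b = 0) := by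
  simp only [← mul_add_eq_zero_iff_of_mul_self hR]
  refine ⟨by rintro rfl k; rfl, fun h => ?_⟩
  rw [eq_iff_mul_of_mul_self hR, mul_eq_left_iff_of_mul_self hR, mul_eq_left_iff_of_mul_self hR]
  exact ⟨fun r => (h r).1, fun r => (h r).2⟩

end BooleanRng

/-! ### The ring operations in terms of algebraic disjointness -/

section GroupRelations

variable {G : Type v} [Group G]

/-- The order on supports, for elements with trivial fifth power. -/
def AlgLE (a b : G) : Prop := ∀ k : G, k ^ 5 = 1 → AlgDisj k b → AlgDisj k a

/-- `a` and `b` have the same support. -/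
def AlgEq (a b : G) : Prop := AlgLE a b ∧ AlgLE b a

/-- The support of `c` is the intersection of those of `a` and `b`. -/
def AlgInf (a b c : G) : Prop :=
  AlgLE c a ∧ AlgLE c b ∧ ∀ k : G, k ^ 5 = 1 → AlgLE k a → AlgLE k b → AlgLE k c

/-- The support of `c` is the symmetric difference of those of `a` and `b`. -/
def AlgSymmDiff (a b c : G) : Prop :=
  ∀ k : G, k ^ 5 = 1 →
    (AlgDisj k c ↔ ∀ m : G, m ^ 5 = 1 → AlgLE m k → (AlgDisj m a ↔ AlgDisj m b))

end GroupRelations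

section Quotients

variable {X : Type u} {κ l : Cardinal.{u}} (hκ : ℵ₀ ≤ κ) (hl : κ < l)

theorem setQuot_mul_self (r : SetQuot X hκ hl) : r * r = r := by
  obtain ⟨A, hA, rfl⟩ := exists_setClass hκ hl r
  exact setClass_congr hκ hl ((mk_le_mk_of_subset Set.inter_subset_left).trans_lt hA) hA
    (Set.inter_self A)

/-- Turns quantifiers over the ring into quantifiers over group elements with trivial fifth power.
-/
theorem forall_suppClass_iff {P : SetQuot X hκ hl → Prop} :
    (∀ r, P r) ↔ ∀ a : SymQuot X hκ hl, a ^ 5 = 1 → P (suppClass hκ hl a) := by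
  refine ⟨fun h a _ => h _, fun h r => ?_⟩
  obtain ⟨a, ha, rfl⟩ := exists_suppClass_eq hκ hl r
  exact h a ha

variable {a b c : SymQuot X hκ hl}

theorem algLE_iff (ha : a ^ 5 = 1) (hb : b ^ 5 = 1) :
    AlgLE a b ↔ suppClass hκ hl a * suppClass hκ hl b = suppClass hκ hl a := by
  rw [mul_eq_left_iff_of_mul_self (setQuot_mul_self hκ hl), forall_suppClass_iff]
  simp only [AlgLE, algDisj_iff hκ hl ha, algDisj_iff hκ hl hb]

theorem algEq_iff (ha : a ^ 5 = 1) (hb : b ^ 5 = 1) :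
    AlgEq a b ↔ suppClass hκ hl a = suppClass hκ hl b := by
  rw [eq_iff_mul_of_mul_self (setQuot_mul_self hκ hl), AlgEq, algLE_iff hκ hl ha hb,
    algLE_iff hκ hl hb ha]

theorem algInf_iff (ha : a ^ 5 = 1) (hb : b ^ 5 = 1) (hc : c ^ 5 = 1) :
    AlgInf a b c ↔ suppClass hκ hl a * suppClass hκ hl b = suppClass hκ hl c := by
  rw [mul_eq_iff_of_mul_self (setQuot_mul_self hκ hl), AlgInf, algLE_iff hκ hl hc ha,
    algLE_iff hκ hl hc hb, forall_suppClass_iff]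
  refine and_congr_right' (and_congr_right' (forall₂_congr fun k hk => ?_))
  rw [algLE_iff hκ hl hk ha, algLE_iff hκ hl hk hb, algLE_iff hκ hl hk hc]

theorem algSymmDiff_iff (ha : a ^ 5 = 1) (hb : b ^ 5 = 1) (hc : c ^ 5 = 1) :
    AlgSymmDiff a b c ↔ suppClass hκ hl a + suppClass hκ hl b = suppClass hκ hl c := by
  rw [add_eq_iff_of_mul_self (setQuot_mul_self hκ hl), AlgSymmDiff, forall_suppClass_iff]
  refine forall₂_congr fun k hk => ?_
  rw [algDisj_iff hκ hl hc, forall_suppClass_iff]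
  refine iff_congr Iff.rfl (forall₂_congr fun m hm => ?_)
  rw [algLE_iff hκ hl hm hk, algDisj_iff hκ hl ha, algDisj_iff hκ hl hb]

end Quotients

/-! ### Formulas in the language of groups -/

section Formulas

open FirstOrder FirstOrder.Language

variable {α : Type}

/-- The term `s * t`. -/
def mulTerm (s t : groupLang.Term α) : groupLang.Term α :=
  Functions.apply₂ (L := groupLang) GroupFunc.mul s t

/-- The term `t⁻¹`. -/
def invTerm (t : groupLang.Term α) : groupLang.Term α :=
  Functions.apply₁ (L := groupLang) GroupFunc.inv t

/-- The term `1`. -/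
def oneTerm : groupLang.Term α :=
  Constants.term (L := groupLang) GroupFunc.one

/-- The term `⁅s, t⁆`. -/
def commTerm (s t : groupLang.Term α) : groupLang.Term α :=
  mulTerm (mulTerm (mulTerm s t) (invTerm s)) (invTerm t)

/-- A term, under one more quantifier. -/
def upTerm (t : groupLang.Term α) : groupLang.Term (Option α) := t.relabel some

/-- The variable bound by the innermost quantifier. -/
def lastVar : groupLang.Term (Option α) := Term.var none

/-- Universal quantification over the variable `none`. -/
noncomputable def allForm (φ : groupLang.Formula (Option α)) : groupLang.Formula α :=
  Formula.iAlls Unit (φ.relabel fun o => o.elim (Sum.inr ()) Sum.inl)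

/-- Existential quantification over the variable `none`. -/
noncomputable def exForm (φ : groupLang.Formula (Option α)) : groupLang.Formula α :=
  Formula.iExs Unit (φ.relabel fun o => o.elim (Sum.inr ()) Sum.inl)

/-- `s` and `t` commute. -/
def commutesForm (s t : groupLang.Term α) : groupLang.Formula α :=
  (mulTerm s t).equal (mulTerm t s)

/-- `t ^ 5 = 1`. -/
def fifthForm (t : groupLang.Term α) : groupLang.Formula α :=
  (mulTerm t (mulTerm t (mulTerm t (mulTerm t t)))).equal oneTerm

/-- The relation `AlgDisj`. -/
noncomputable def disjForm (t g : groupLang.Term α) : groupLang.Formula α :=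
  allForm ((commutesForm lastVar (upTerm t)).not ⟹ exForm (exForm
    -- Under the three quantifiers, `h`, `p`, `q` are `upTerm (upTerm lastVar)`, `upTerm lastVar`,
    -- `lastVar`.
    (commutesForm (upTerm lastVar) (upTerm (upTerm (upTerm g))) ⊓
      (commutesForm lastVar (upTerm (upTerm (upTerm g))) ⊓
        (commutesForm (commTerm (commTerm (upTerm (upTerm lastVar)) (upTerm lastVar)) lastVar)
            (upTerm (upTerm (upTerm g))) ⊓
          ((commTerm (commTerm (upTerm (upTerm lastVar)) (upTerm lastVar)) lastVar).equal
            oneTerm).not)))))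

/-- The relation `AlgLE`. -/
noncomputable def leForm (a b : groupLang.Term α) : groupLang.Formula α :=
  allForm (fifthForm lastVar ⟹ disjForm lastVar (upTerm b) ⟹ disjForm lastVar (upTerm a))

/-- The relation `AlgEq`. -/
noncomputable def eqForm (a b : groupLang.Term α) : groupLang.Formula α := leForm a b ⊓ leForm b a

/-- The relation `AlgInf`. -/
noncomputable def infForm (a b c : groupLang.Term α) : groupLang.Formula α :=
  leForm c a ⊓ (leForm c b ⊓ allForm (fifthForm lastVar ⟹ leForm lastVar (upTerm a) ⟹
    leForm lastVar (upTerm b) ⟹ leForm lastVar (upTerm c)))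

/-- The relation `AlgSymmDiff`. -/
noncomputable def symmDiffForm (a b c : groupLang.Term α) : groupLang.Formula α :=
  allForm (fifthForm lastVar ⟹ (disjForm lastVar (upTerm c)).iff
    (allForm (fifthForm lastVar ⟹ leForm lastVar (upTerm lastVar) ⟹
      (disjForm lastVar (upTerm (upTerm a))).iff (disjForm lastVar (upTerm (upTerm b))))))

variable {G : Type v} [Group G] {x : α → G}

@[simp] theorem realize_mulTerm (s t : groupLang.Term α) :
    (mulTerm s t).realize x = s.realize x * t.realize x := by
  exact Term.realize_functions_apply₂

@[simp] theorem realize_invTerm (t : groupLang.Term α) :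
    (invTerm t).realize x = (t.realize x)⁻¹ := by
  exact Term.realize_functions_apply₁

@[simp] theorem realize_oneTerm : (oneTerm : groupLang.Term α).realize x = 1 := by
  exact Term.realize_constants

@[simp] theorem realize_commTerm (s t : groupLang.Term α) :
    (commTerm s t).realize x = ⁅s.realize x, t.realize x⁆ := by
  simp [commTerm, commutatorElement_def]

@[simp] theorem realize_upTerm (t : groupLang.Term α) (y : G) :
    (upTerm t).realize (fun o : Option α => o.elim y x) = t.realize x := by
  rw [upTerm, Term.realize_relabel]; rfl

@[simp] theorem realize_lastVar (y : G) :
    (lastVar : groupLang.Term (Option α)).realize (fun o : Option α => o.elim y x) = y := rfl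

@[simp] theorem realize_allForm (φ : groupLang.Formula (Option α)) :
    (allForm φ).Realize x ↔ ∀ y : G, φ.Realize fun o : Option α => o.elim y x := by
  have h : ∀ i : Unit → G, (Sum.elim x i ∘ fun o : Option α => o.elim (Sum.inr ()) Sum.inl) =
      fun o : Option α => o.elim (i ()) x := by
    intro i; funext o; cases o <;> rfl
  simp only [allForm, Formula.realize_iAlls, Formula.realize_relabel, h]
  exact ⟨fun H y => H fun _ => y, fun H i => H (i ())⟩

@[simp] theorem realize_exForm (φ : groupLang.Formula (Option α)) :
    (exForm φ).Realize x ↔ ∃ y : G, φ.Realize fun o : Option α => o.elim y x := by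
  have h : ∀ i : Unit → G, (Sum.elim x i ∘ fun o : Option α => o.elim (Sum.inr ()) Sum.inl) =
      fun o : Option α => o.elim (i ()) x := by
    intro i; funext o; cases o <;> rfl
  simp only [exForm, Formula.realize_iExs, Formula.realize_relabel, h]
  exact ⟨fun ⟨i, H⟩ => ⟨i (), H⟩, fun ⟨y, H⟩ => ⟨fun _ => y, H⟩⟩

@[simp] theorem realize_commutesForm (s t : groupLang.Term α) :
    (commutesForm s t).Realize x ↔
      s.realize x * t.realize x = t.realize x * s.realize x := by
  simp [commutesForm]

@[simp] theorem realize_fifthForm (t : groupLang.Term α) :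
    (fifthForm t).Realize x ↔ t.realize x ^ 5 = 1 := by
  simp [fifthForm, pow_succ, mul_assoc]

@[simp] theorem realize_disjForm (s t : groupLang.Term α) :
    (disjForm s t).Realize x ↔ AlgDisj (s.realize x) (t.realize x) := by
  simp [disjForm, AlgDisj]

@[simp] theorem realize_leForm (s t : groupLang.Term α) :
    (leForm s t).Realize x ↔ AlgLE (s.realize x) (t.realize x) := by
  simp [leForm, AlgLE]

@[simp] theorem realize_eqForm (s t : groupLang.Term α) :
    (eqForm s t).Realize x ↔ AlgEq (s.realize x) (t.realize x) := by
  simp [eqForm, AlgEq]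

@[simp] theorem realize_infForm (r s t : groupLang.Term α) :
    (infForm r s t).Realize x ↔ AlgInf (r.realize x) (s.realize x) (t.realize x) := by
  simp [infForm, AlgInf]

@[simp] theorem realize_symmDiffForm (r s t : groupLang.Term α) :
    (symmDiffForm r s t).Realize x ↔
      AlgSymmDiff (r.realize x) (s.realize x) (t.realize x) := by
  simp [symmDiffForm, AlgSymmDiff]

/-- The interpretation of `P_l(X) / P_κ(X)` in `S_l(X) / S_κ(X)`: elements are represented by the
supports of group elements with trivial fifth power. -/
noncomputable def supportInterpretation : Interpretation groupLang rngLang where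
  dim := 1
  dom := fifthForm (Term.var 0)
  eqv := eqForm (Term.var (0, 0)) (Term.var (1, 0))
  func := fun {_} s => match s with
    -- Only zero is disjoint from itself; and negation is the identity in characteristic two.
    | RngFunc.zero => disjForm (Term.var (0, 0)) (Term.var (0, 0))
    | RngFunc.neg => eqForm (Term.var (0, 0)) (Term.var (1, 0))
    | RngFunc.add => symmDiffForm (Term.var (0, 0)) (Term.var (1, 0)) (Term.var (2, 0))
    | RngFunc.mul => infForm (Term.var (0, 0)) (Term.var (1, 0)) (Term.var (2, 0))
  rel := fun s => Empty.elim s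

/-- The formula saying that `g` sends the element represented by `a` to that represented by `b`:
the conjugate `g * a * g⁻¹` has the same support as `b`. -/
noncomputable def actionFormula : groupLang.Formula (Unit ⊕ Fin 2 × Fin 1) :=
  eqForm (mulTerm (mulTerm (Term.var (Sum.inl ())) (Term.var (Sum.inr (0, 0))))
    (invTerm (Term.var (Sum.inl ())))) (Term.var (Sum.inr (1, 0)))

end Formulas

end QuotSym

theorem corollary3p9 :
    ∃ (I : QuotSym.Interpretation QuotSym.groupLang QuotSym.rngLang)
      (act : QuotSym.groupLang.Formula (Unit ⊕ Fin 2 × Fin I.dim)),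
      ∀ (X : Type u) (κ l : Cardinal.{u}) (hκ : ℵ₀ ≤ κ) (hl : κ < l) (_ : l ≤ Order.succ #X),
        ∃ f : I.Dom (QuotSym.SymQuot X hκ hl) → QuotSym.SetQuot X hκ hl,
          I.IsCoordinateMap f ∧
          ∀ (g : QuotSym.SymQuot X hκ hl) (x : Fin 2 → I.Dom (QuotSym.SymQuot X hκ hl)),
            act.Realize (Sum.elim (fun _ => g) (QuotSym.blocks fun i => (x i).1)) ↔
              QuotSym.quotAction hκ hl g (f (x 0)) = f (x 1) := by
  open QuotSym in
  refine ⟨supportInterpretation, actionFormula, fun X κ l hκ hl _ => ?_⟩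
  have hdom : ∀ a : supportInterpretation.Dom (SymQuot X hκ hl), a.1 (0 : Fin 1) ^ 5 = 1 :=
    fun a => (realize_fifthForm _).1 a.2
  have hR := setQuot_mul_self (X := X) hκ hl
  refine ⟨fun a => suppClass hκ hl (a.1 (0 : Fin 1)), ⟨fun r => ?_, fun x => ?_, fun {k} s x => ?_,
    fun s => Empty.elim s⟩, fun g x => ?_⟩
  · obtain ⟨a, ha, rfl⟩ := exists_suppClass_eq hκ hl r
    exact ⟨⟨fun _ => a, (realize_fifthForm _).2 ha⟩, rfl⟩
  · exact (realize_eqForm _ _).trans (algEq_iff hκ hl (hdom _) (hdom _))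
  · change RngFunc k at s
    cases s with
    | zero =>
      refine (realize_disjForm _ _).trans ((algDisj_iff hκ hl (hdom (x 0))).trans ?_)
      exact (congrArg (· = 0) (hR _)).to_iff.trans eq_comm
    | neg =>
      refine (realize_eqForm _ _).trans ((algEq_iff hκ hl (hdom (x 0)) (hdom (x 1))).trans ?_)
      exact (congrArg (· = suppClass hκ hl ((x 1).1 (0 : Fin 1)))
        (neg_eq_of_mul_self hR _).symm).to_iff
    | add =>
      exact (realize_symmDiffForm _ _ _).trans
        (algSymmDiff_iff hκ hl (hdom (x 0)) (hdom (x 1)) (hdom (x 2)))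
    | mul =>
      exact (realize_infForm _ _ _).trans
        (algInf_iff hκ hl (hdom (x 0)) (hdom (x 1)) (hdom (x 2)))
  -- The conjugate must itself be a valid code for `algEq_iff` to apply.
  · have h5 : (g * (x 0).1 (0 : Fin 1) * g⁻¹) ^ 5 = 1 := by
      rw [conj_pow, hdom, mul_one, mul_inv_cancel]
    refine (realize_eqForm _ _).trans ((algEq_iff hκ hl h5 (hdom (x 1))).trans ?_)
    rw [suppClass_conj]
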